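/- A virtual knot diagram is a diagram in the plane of one closed curve whose double points are classical crossings (with over/under information) or virtual crossings; two such diagrams are virtually equivalent if they are related by planar isotopy, the classical Reidemeister moves I, II, III, the virtual Reidemeister moves I, II, III (all crossings virtual), and the mixed third move (a strand with two virtual crossings passes a classical crossing). For a nonempty virtual link diagram $K$ let $$\langle K\rangle=\sum_{s}A^{c(s)}d^{|s|-1}\in\mathbb Z[A,A^{-1}],\qquad d=-A^{2}-A^{-2},$$ where $s$ runs over the states of $K$ (a choice of the smoothing $\alpha$ or $\beta$ at every classical crossing, the virtual crossings being kept), $c(s)$ is the number of $\alpha$-smoothings minus the number of $\beta$-smoothings, and $|s|$ is the number of closed curves of $s$. Let $\langle K\rangle_N=\langle K_N\rangle$, where $K_N$ consists of $N$ parallel copies of $K$ (each classical or virtual crossing is replaced by $N^2$ crossings of the same kind). Let $K_D$ be the virtual knot diagram with eight classical and two virtual crossings whose signed Gauss code (the sequence of over- and under-passages through the classical crossings, with the signs of the crossings) is $$U_1^+O_2^+O_1^+O_3^-U_4^-U_2^+O_4^-U_3^-\;U_5^+O_6^+U_7^-U_6^+O_5^+O_8^-O_7^-U_8^- ;$$ it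 is the closure of the composition of two $1$-$1$ tangles (crossings $1$ to $4$ and $5$ to $8$), each with one virtual crossing, which lies on the arc from $O_2$ to $O_1$ and on the arc from $U_2$ to $O_4$ in the first tangle, and on the arc from $O_6$ to $U_7$ and on the arc from $O_8$ to $O_7$ in the second one. Then $\langle K_D\rangle=1$ and $\langle K_D\rangle_2=d$, which are also the values of the crossingless diagram $U$ of the unknot: $\langle U\rangle=1$, $\langle U\rangle_2=d$, $\langle U\rangle_3=d^2$. However, with $s_k=A^k+A^{-k}$, $$\langle K_D\rangle_3=d\,\bigl( -1842 +s_{76} -2s_{72} -2s_{70} -3s_{68} -8s_{66} -18s_{64} -17s_{62} -8s_{60} -5s_{58} -2s_{56} +21s_{54} +66s_{52} +95s_{50} +103s_{48} +114s_{46} +136s_{44} +111s_{42} +11s_{40} -110s_{38} -209s_{36} -326s_{34} -491s_{32} -601s_{30} -559s_{28} -380s_{26} -178s_{24} +142s_{22} +594s_{20} +1050s_{18} +1329s_{16} +1334s_{14} +1215s_{12} +814s_{10} +193s_{8} -573s_{6} -1257s_{4} -1660s_{2} \bigr),$$ so that $\langle K_D\rangle_3\neq d^2$. Moreover $K_D$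 is not virtually equivalent to the unknot. -/

import Mathlib

open scoped LaurentPolynomial

namespace VirtualKnot

/-! ### Virtual diagrams in the plane

A virtual link diagram in the plane is put in general position with respect to the height function
and read from bottom to top.  It becomes a list of layers; each layer contains one local minimum,
one local maximum, one classical crossing or one virtual crossing, and all the other strands run
vertically.  The strands at a given height are numbered `0, 1, 2, …` from left to right. -/

/-- The crossings of a virtual diagram.  Both strands rise.
* `over`: classical, the strand from the lower left to the upper right passes over the other one;
* `under`: classical, the strand from the lower left to the upper right passes under the other one;
* `virt`: virtual. -/
inductive Crossing
  | over
  | under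
  | virt

/-- Exchange the roles of the two strands of a crossing. -/
def Crossing.switch : Crossing → Crossing
  | .over => .under
  | .under => .over
  | .virt => .virt

/-- The pieces of a diagram: a local minimum `cup`, a local maximum `cap`, or a crossing. -/
inductive Piece
  | cup
  | cap
  | cross (c : Crossing)

/-- The number of strands that enter a piece from below. -/
def Piece.inputs : Piece → ℕ
  | .cup => 0
  | .cap => 2
  | .cross _ => 2

/-- The number of strands that leave a piece at the top. -/
def Piece.outputs : Piece → ℕ
  | .cup => 2
  | .cap => 0
  | .cross _ => 2

/-- `(p, i)` is the layer with the piece `p` that has exactly `i` strands to the left of `p`. -/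
abbrev Layer := Piece × ℕ

/-- A list of layers, from bottom to top. -/
abbrev Word := List Layer

/-- A local minimum with `i` strands to its left. -/
abbrev cup (i : ℕ) : Layer := (Piece.cup, i)

/-- A local maximum with `i` strands to the left of it; it joins the strands `i` and `i + 1`. -/
abbrev cap (i : ℕ) : Layer := (Piece.cap, i)

/-- A crossing of the strands `i` and `i + 1`. -/
abbrev cross (c : Crossing) (i : ℕ) : Layer := (Piece.cross c, i)

/-- The number of strands above a layer with `n` strands below it; `none` if the layer does not
fit on `n` strands. -/
def Layer.width (l : Layer) (n : ℕ) : Option ℕ :=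
  if l.2 + l.1.inputs ≤ n then some (n - l.1.inputs + l.1.outputs) else none

/-- The number of strands above a word with `n` strands below it; `none` if the layers do not fit
together. -/
def Word.width : Word → ℕ → Option ℕ
  | [], n => some n
  | l :: w, n => (Layer.width l n).bind (Word.width w)

/-- A word is a closed diagram if its layers fit together and it has no free ends. -/
def Word.IsClosed (w : Word) : Prop := Word.width w 0 = some 0

/-- Count the closed curves of a word, where strands go straight through all crossings.  The list
`s` gives, from left to right, for each strand at the current height the label of the arc (of the
part of the diagram below) to which it belongs; `k` is the next label not yet in use.  A local
maximum that joins two ends of one arc closes a curve, otherwise it merges two arcs. -/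
def curvesFrom : Word → List ℕ → ℕ → ℕ
  | [], _, _ => 0
  | (.cup, i) :: w, s, k => curvesFrom w (s.take i ++ k :: k :: s.drop i) (k + 1)
  | (.cap, i) :: w, s, k =>
    match s.drop i with
    | a :: b :: t =>
      (if a = b then 1 else 0)
        + curvesFrom w ((s.take i ++ t).map fun c => if c = b then a else c) k
    | _ => 0
  | (.cross _, i) :: w, s, k =>
    match s.drop i with
    | a :: b :: t => curvesFrom w (s.take i ++ b :: a :: t) k
    | _ => 0

/-- The number of closed curves of a closed diagram, where strands go straight through all
crossings, classical or virtual. -/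
def Word.curves (w : Word) : ℕ := curvesFrom w [] 0

/-- A virtual knot diagram: a diagram in the plane of a single closed curve, with classical and
virtual crossings. -/
@[ext]
structure VirtualKnotDiagram where
  /-- the layers, from bottom to top -/
  word : Word
  isClosed : word.IsClosed
  isKnot : word.curves = 1

/-! ### Virtual equivalence -/

/-- The third Reidemeister moves.  The arguments are the crossing of strands 1 and 2, of strands
1 and 3, and of strands 2 and 3 of three strands that cross pairwise.  The move is allowed if all
three crossings are classical and one strand is on top, one in the middle and one at the bottom;
or if all three are virtual; or if exactly two of them are virtual (a strand with only virtual
crossings moves past a classical crossing).  Two classical and one virtual crossing are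
forbidden. -/
def ThirdMoveAllowed : Crossing → Crossing → Crossing → Prop
  | .virt, .virt, _ => True
  | .virt, _, .virt => True
  | _, .virt, .virt => True
  | .virt, _, _ => False
  | _, .virt, _ => False
  | _, _, .virt => False
  | .over, .under, .over => False
  | .under, .over, .under => False
  | _, _, _ => True

/-- The local moves.  The first five generate planar isotopy, the others are the classical,
virtual and mixed Reidemeister moves. -/
inductive LocalMove : Word → Word → Prop
  /-- two pieces next to each other exchange their heights; `k` strands run between them -/
  | exchange (p q : Piece) (i k : ℕ) :
      LocalMove [(p, i), (q, i + p.outputs + k)] [(q, i + p.inputs + k), (p, i)]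
  /-- straighten a strand -/
  | zigzag_left (i : ℕ) : LocalMove [cup i, cap (i + 1)] []
  /-- straighten a strand -/
  | zigzag_right (i : ℕ) : LocalMove [cup (i + 1), cap i] []
  /-- slide a crossing through a local minimum -/
  | slide_cup (c : Crossing) (i : ℕ) :
      LocalMove [cup i, cross c (i + 1)] [cup (i + 1), cross c.switch i]
  /-- slide a crossing through a local maximum -/
  | slide_cap (c : Crossing) (i : ℕ) :
      LocalMove [cross c (i + 1), cap i] [cross c.switch i, cap (i + 1)]
  /-- first move, classical and virtual -/
  | first_cup (c : Crossing) (i : ℕ) : LocalMove [cup i, cross c i] [cup i]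
  /-- first move, classical and virtual -/
  | first_cap (c : Crossing) (i : ℕ) : LocalMove [cross c i, cap i] [cap i]
  /-- second move, classical and virtual -/
  | second (c : Crossing) (i : ℕ) : LocalMove [cross c i, cross c.switch i] []
  /-- third move, classical, virtual and mixed -/
  | third (c₁₂ c₁₃ c₂₃ : Crossing) (h : ThirdMoveAllowed c₁₂ c₁₃ c₂₃) (i : ℕ) :
      LocalMove [cross c₁₂ i, cross c₁₃ (i + 1), cross c₂₃ i]
        [cross c₂₃ (i + 1), cross c₁₃ i, cross c₁₂ (i + 1)]

/-- `K'` arises from `K` by one local move applied to some consecutive layers. -/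
def Step (K K' : VirtualKnotDiagram) : Prop :=
  ∃ u l r v : Word, LocalMove l r ∧ K.word = u ++ l ++ v ∧ K'.word = u ++ r ++ v

/-- Virtual equivalence: a finite sequence of local moves and their inverses transforms `K` into
`K'`. -/
def VirtuallyEquivalent : VirtualKnotDiagram → VirtualKnotDiagram → Prop :=
  Relation.EqvGen Step

/-! ### The bracket polynomial -/

/-- The two smoothings of a layer with a classical crossing, each with its contribution to
`#α - #β`, where `α` is the smoothing that joins the two regions swept out by the over-crossing
strand when it is turned counterclockwise; it has weight `1` and `β` has weight `-1`.  Two vertical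
strands are the empty word, and a maximum below a minimum is `[cap i, cup i]`.  Layers without a
classical crossing are left as they are. -/
def smoothings : Layer → List (Word × ℤ)
  | (.cross .over, i) => [([], 1), ([cap i, cup i], -1)]
  | (.cross .under, i) => [([cap i, cup i], 1), ([], -1)]
  | l => [([l], 0)]

/-- All states `s` of a diagram, one for each choice of a smoothing at every classical crossing,
each with the number `c(s)` of smoothings of type `α` minus the number of those of type `β`. -/
def states : Word → List (Word × ℤ)
  | [] => [([], 0)]
  | l :: w =>
    (smoothings l).flatMap fun a => (states w).map fun b => (a.1 ++ b.1, a.2 + b.2)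

/-- `d = -A⁻² - A²`, where `A` is the variable `LaurentPolynomial.T 1`. -/
noncomputable def d : ℤ[T;T⁻¹] := -LaurentPolynomial.T (-2) - LaurentPolynomial.T 2

/-- The bracket polynomial `∑ₛ A^{c(s)} d^{|s| - 1}` of a (nonempty) virtual link diagram, where
`|s|` is the number of closed curves of the state `s`. -/
noncomputable def bracket (w : Word) : ℤ[T;T⁻¹] :=
  ((states w).map fun s => LaurentPolynomial.T s.2 * d ^ (s.1.curves - 1)).sum

/-- The `N` parallel copies of a layer: `N` nested minima or maxima, or `N²` crossings of the same
kind, where `N` parallel strands cross `N` parallel strands. -/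
def Layer.parallel (N : ℕ) : Layer → Word
  | (.cup, i) => (List.range N).map fun a => cup (N * i + a)
  | (.cap, i) => (List.range N).map fun a => cap (N * i + (N - 1 - a))
  | (.cross c, i) =>
    (List.range N).flatMap fun a =>
      (List.range N).map fun b => cross c (N * i + a + (N - 1 - b))

/-- The virtual link diagram `K_N` formed by `N` parallel copies of a diagram `K`. -/
def Word.parallel (N : ℕ) (w : Word) : Word := w.flatMap (Layer.parallel N)

/-- The bracket polynomial `⟨K⟩` of a virtual knot diagram. -/
noncomputable def VirtualKnotDiagram.bracket (K : VirtualKnotDiagram) : ℤ[T;T⁻¹] :=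
  VirtualKnot.bracket K.word

/-- The `N`-strand bracket polynomial `⟨K⟩_N = ⟨K_N⟩`, for `N ≥ 1`. -/
noncomputable def VirtualKnotDiagram.strandBracket (N : ℕ) (K : VirtualKnotDiagram) : ℤ[T;T⁻¹] :=
  VirtualKnot.bracket (K.word.parallel N)

/-! ### The unknot and the diagram `K_D` -/

/-- The diagram of the unknot without crossings. -/
def unknot : VirtualKnotDiagram where
  word := [cup 0, cap 0]
  isClosed := by rfl
  isKnot := by rfl

/-- The diagram `K_D`, with eight classical and two virtual crossings.  It is the closure of the
composition of two `1`-`1` tangles with four classical crossings and one virtual crossing each.  Its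
signed Gauss code is
`U1+ O2+ O1+ O3- U4- U2+ O4- U3- U5+ O6+ U7- U6+ O5+ O8- O7- U8-`. -/
def KD : VirtualKnotDiagram where
  word :=
    [cup 0,
      cup 0, cup 1, cross .virt 0,
      cross .over 1, cross .over 0, cross .over 0, cross .over 1,
      cap 2, cap 1,
      cup 0, cup 1, cross .virt 2,
      cross .under 1, cross .under 2, cross .under 2, cross .under 1,
      cap 0, cap 1,
      cap 0]
  isClosed := by rfl
  isKnot := by rfl

end VirtualKnot

/-!
Colourings of an unoriented diagram by an involutory quandle are preserved by all virtual moves, as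
a virtual crossing just lets the colours pass. The dihedral quandle of order three colours `K_D` in
nine ways and the unknot in three, so they are not virtually equivalent.

For the brackets, read a diagram from bottom to top and keep the states of the part read so far as
a linear combination of perfect matchings of the open ends: a cup adds an arc, a cap joins two
arcs, with the factor `d` if it closes a curve, a virtual crossing only exchanges two ends, and a
classical crossing is `A + A⁻¹ E` or `A⁻¹ + A E`, where `E` is a cap followed by a cup. With
`r = A⁻²`, these are `A (1 + r E)` and `A³ (r² + r E)`, and `r d = -(1 + r²)`; hence a factor `r`
for each cap makes the state sum, up to a power of `A`, an integer polynomial in `r`. Its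
coefficients are bounded by a product with a factor `2` for each cap and `3` for each classical
crossing, so it is determined by its value at the single integer `r = 3 ^ 100`, and this is computed
with integers only. In the cable of `K_D` the two tangles act on disjoint arcs, so that the
computation can be done for each of them separately, and its result is the product.
-/

namespace VirtualKnot

section Width

theorem Word.width_append (u v : Word) (n : ℕ) :
    (u ++ v).width n = (u.width n).bind v.width := by
  induction u generalizing n with
  | nil => rfl
  | cons l u ih =>
    simp only [List.cons_append, Word.width]
    cases Layer.width l n <;> simp [ih]

theorem Word.width_cons_eq_some {l : Layer} {w : Word} {n k : ℕ} :
    Word.width (l :: w) n = some k ↔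
      l.2 + l.1.inputs ≤ n ∧ Word.width w (n - l.1.inputs + l.1.outputs) = some k := by
  simp only [Word.width, Layer.width]
  split <;> simp [*]

theorem exists_eq_append_append {α : Type*} {s : List α} {i n : ℕ} (h : i + n ≤ s.length) :
    ∃ a b c, s = a ++ (b ++ c) ∧ a.length = i ∧ b.length = n :=
  ⟨s.take i, (s.drop i).take n, (s.drop i).drop n, by simp, by simp; omega, by simp; omega⟩

end Width

/-! ### Quandle colourings -/

section Colorings

open Quandles

variable {Q : Type*}

/-- The colours of the upper ends of a crossing whose lower ends have the colours `x` and `y`: the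
strand that passes under is acted on by the one that passes over. -/
def Crossing.color [Quandle Q] : Crossing → Q → Q → Q × Q
  | .over, x, y => (x ◃ y, x)
  | .under, x, y => (y, y ◃ x)
  | .virt, x, y => (y, x)

section Moves

variable [Quandle Q]

theorem Crossing.color_self (c : Crossing) (x : Q) : c.color x x = (x, x) := by
  cases c <;> simp [Crossing.color]

theorem Crossing.color_fst_eq_snd_iff (c : Crossing) (x y : Q) :
    (c.color x y).1 = (c.color x y).2 ↔ x = y := by
  have eq_act_iff (x y : Q) : x ◃ y = x ↔ y = x := by
    rw [← Rack.left_cancel x (y := y), Quandle.fix]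
  cases c
  · exact (eq_act_iff x y).trans eq_comm
  · exact eq_comm.trans (eq_act_iff y x)
  · exact eq_comm

theorem Crossing.color_switch (hQ : Rack.IsInvolutory Q) (c : Crossing) (x y : Q) :
    c.switch.color (c.color x y).1 (c.color x y).2 = (x, y) := by
  cases c
  · simp [Crossing.color, Crossing.switch, hQ x y]
  · simp [Crossing.color, Crossing.switch, hQ y x]
  · rfl

theorem Crossing.color_third (hQ : Rack.IsInvolutory Q) {c₁₂ c₁₃ c₂₃ : Crossing}
    (h : ThirdMoveAllowed c₁₂ c₁₃ c₂₃) (x y z : Q) :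
    let p := c₁₂.color x y
    let q := c₁₃.color p.2 z
    let p' := c₂₃.color p.1 q.1
    let r := c₂₃.color y z
    let s := c₁₃.color x r.1
    let r' := c₁₂.color s.2 r.2
    p'.1 = s.1 ∧ p'.2 = r'.1 ∧ q.2 = r'.2 := by
  have act_act (x y : Q) : x ◃ x ◃ y = y := hQ x y
  have act_act_act (x y z : Q) : x ◃ (x ◃ y) ◃ z = y ◃ x ◃ z := by
    rw [Shelf.self_distrib, act_act]
  cases c₁₂ <;> cases c₁₃ <;> cases c₂₃ <;>
    simp_all [ThirdMoveAllowed, Crossing.color, ← Shelf.self_distrib]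

theorem Crossing.color_slide_cap_iff (hQ : Rack.IsInvolutory Q) (c : Crossing) (x y z : Q) :
    x = (c.color y z).1 ↔ (c.switch.color x y).2 = z := by
  have act_eq_iff (x y z : Q) : x ◃ y = z ↔ x ◃ z = y := (hQ x).eq_iff.trans eq_comm
  cases c
  · exact eq_comm.trans (act_eq_iff y z x)
  · rfl
  · rfl

theorem Crossing.color_slide_cap (c : Crossing) {x y z : Q} (h : x = (c.color y z).1) :
    (c.color y z).2 = (c.switch.color x y).1 := by
  cases c <;> simp_all [Crossing.color, Crossing.switch]

theorem Crossing.sum_color_slide_cup [Fintype Q] {M : Type*} [AddCommMonoid M]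
    (hQ : Rack.IsInvolutory Q) (c : Crossing) (F : Q → Q → Q → M) (y : Q) :
    ∑ x, F x (c.color x y).1 (c.color x y).2 =
      ∑ z, F (c.switch.color y z).1 (c.switch.color y z).2 z := by
  cases c
  · rfl
  · exact Fintype.sum_bijective _ (hQ y).bijective _ _ fun x => by
      simp [Crossing.color, Crossing.switch, hQ y x]
  · rfl

end Moves

variable [Quandle Q] [Fintype Q] [DecidableEq Q]

/-- The colourings of the upper ends of a piece for given colours of its lower ends. -/
def Piece.colors : Piece → List Q → Multiset (List Q)
  | .cup, [] => Finset.univ.val.map fun x => [x, x]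
  | .cap, [x, y] => if x = y then {[]} else 0
  | .cross c, [x, y] => {[(c.color x y).1, (c.color x y).2]}
  | _, _ => 0

/-- The number of colourings of a word by a finite quandle, for given colours of its lower ends.
Strands are not oriented, so this is invariant only if the quandle is involutory. -/
def colorings : Word → List Q → ℕ
  | [], _ => 1
  | (p, i) :: w, s =>
    ((p.colors ((s.drop i).take p.inputs)).map fun o =>
      colorings w (s.take i ++ (o ++ s.drop (i + p.inputs)))).sum

theorem length_of_mem_colors {p : Piece} {b o : List Q} (h : o ∈ p.colors b) :
    o.length = p.outputs := by
  unfold Piece.colors at h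
  split at h
  · obtain ⟨x, -, rfl⟩ := Multiset.mem_map.1 h
    rfl
  · split at h <;> simp_all [Piece.outputs]
  · simp_all [Piece.outputs]
  · simp at h

theorem colorings_cons (p : Piece) (w : Word) (a b c : List Q) (h : b.length = p.inputs) :
    colorings ((p, a.length) :: w) (a ++ (b ++ c)) =
      ((p.colors b).map fun o => colorings w (a ++ (o ++ c))).sum := by
  simp [colorings, ← h, ← List.drop_drop]

theorem colorings_cup (w : Word) (a t : List Q) :
    colorings (cup a.length :: w) (a ++ t) = ∑ x, colorings w (a ++ x :: x :: t) := by
  rw [← List.nil_append t, colorings_cons _ _ _ _ _ rfl]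
  simp [Piece.colors, Multiset.map_map]

theorem colorings_cap (w : Word) (a t : List Q) (x y : Q) :
    colorings (cap a.length :: w) (a ++ x :: y :: t) =
      if x = y then colorings w (a ++ t) else 0 := by
  rw [show x :: y :: t = [x, y] ++ t from rfl, colorings_cons _ _ _ _ _ rfl, Piece.colors]
  split <;> simp

theorem colorings_cross (c : Crossing) (w : Word) (a t : List Q) (x y : Q) :
    colorings (cross c a.length :: w) (a ++ x :: y :: t) =
      colorings w (a ++ (c.color x y).1 :: (c.color x y).2 :: t) := by
  rw [show x :: y :: t = [x, y] ++ t from rfl, colorings_cons _ _ _ _ _ rfl]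
  simp [Piece.colors]

theorem colorings_cup_succ (w : Word) (a t : List Q) (u : Q) :
    colorings (cup (a.length + 1) :: w) (a ++ u :: t) =
      ∑ x, colorings w (a ++ u :: x :: x :: t) := by
  simpa using colorings_cup w (a ++ [u]) t

theorem colorings_cap_succ (w : Word) (a t : List Q) (u x y : Q) :
    colorings (cap (a.length + 1) :: w) (a ++ u :: x :: y :: t) =
      if x = y then colorings w (a ++ u :: t) else 0 := by
  simpa using colorings_cap w (a ++ [u]) t x y

theorem colorings_cross_succ (c : Crossing) (w : Word) (a t : List Q) (u x y : Q) :
    colorings (cross c (a.length + 1) :: w) (a ++ u :: x :: y :: t) =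
      colorings w (a ++ u :: (c.color x y).1 :: (c.color x y).2 :: t) := by
  simpa using colorings_cross c w (a ++ [u]) t x y

variable {v : Word} {s : List Q} {i : ℕ}

theorem colorings_exchange (p q : Piece) {k : ℕ} (h : i + p.inputs + k + q.inputs ≤ s.length) :
    colorings ((p, i) :: (q, i + p.outputs + k) :: v) s =
      colorings ((q, i + p.inputs + k) :: (p, i) :: v) s := by
  obtain ⟨a, b, u, rfl, rfl, hb⟩ := exists_eq_append_append (s := s) (i := i) (n := p.inputs)
    (by omega)
  obtain ⟨c, e, f, rfl, rfl, he⟩ := exists_eq_append_append (s := u) (i := k) (n := q.inputs)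
    (by simp only [List.length_append] at h; omega)
  have apply_q (w : Word) (g : List Q) :
      colorings ((q, a.length + g.length + c.length) :: w) (a ++ (g ++ (c ++ (e ++ f)))) =
        ((q.colors e).map fun o => colorings w (a ++ (g ++ (c ++ (o ++ f))))).sum := by
    simpa [add_assoc] using colorings_cons q w (a ++ g ++ c) e f he
  calc
    _ = ((p.colors b).map fun o => ((q.colors e).map fun o' =>
          colorings v (a ++ (o ++ (c ++ (o' ++ f))))).sum).sum := by
      rw [colorings_cons _ _ _ _ _ hb]
      refine congrArg Multiset.sum (Multiset.map_congr rfl fun o ho => ?_)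
      rw [← length_of_mem_colors ho, apply_q]
    _ = ((q.colors e).map fun o' => ((p.colors b).map fun o =>
          colorings v (a ++ (o ++ (c ++ (o' ++ f))))).sum).sum :=
      Multiset.sum_map_sum_map _ _
    _ = _ := by
      rw [← hb, apply_q]
      simp only [colorings_cons _ _ _ _ _ hb]

theorem colorings_zigzag_left (h : i + 1 ≤ s.length) :
    colorings (cup i :: cap (i + 1) :: v) s = colorings v s := by
  obtain ⟨a, b, t, rfl, rfl, hb⟩ := exists_eq_append_append h
  obtain ⟨x, rfl⟩ := List.length_eq_one_iff.1 hb
  simp [colorings_cup, colorings_cap_succ]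

theorem colorings_zigzag_right (h : i + 1 ≤ s.length) :
    colorings (cup (i + 1) :: cap i :: v) s = colorings v s := by
  obtain ⟨a, b, t, rfl, rfl, hb⟩ := exists_eq_append_append h
  obtain ⟨x, rfl⟩ := List.length_eq_one_iff.1 hb
  simp [colorings_cup_succ, colorings_cap]

theorem colorings_slide_cup (hQ : Rack.IsInvolutory Q) (c : Crossing) (h : i + 1 ≤ s.length) :
    colorings (cup i :: cross c (i + 1) :: v) s =
      colorings (cup (i + 1) :: cross c.switch i :: v) s := by
  obtain ⟨a, b, t, rfl, rfl, hb⟩ := exists_eq_append_append h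
  obtain ⟨x, rfl⟩ := List.length_eq_one_iff.1 hb
  simp only [List.singleton_append, colorings_cup, colorings_cup_succ, colorings_cross,
    colorings_cross_succ]
  exact c.sum_color_slide_cup hQ (fun x y z => colorings v (a ++ x :: y :: z :: t)) x

theorem colorings_slide_cap (hQ : Rack.IsInvolutory Q) (c : Crossing) (h : i + 3 ≤ s.length) :
    colorings (cross c (i + 1) :: cap i :: v) s =
      colorings (cross c.switch i :: cap (i + 1) :: v) s := by
  obtain ⟨a, b, t, rfl, rfl, hb⟩ := exists_eq_append_append h
  obtain ⟨x, y, z, rfl⟩ := List.length_eq_three.1 hb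
  simp only [List.cons_append, List.nil_append, colorings_cap, colorings_cap_succ,
    colorings_cross, colorings_cross_succ]
  by_cases hx : x = (c.color y z).1
  · rw [if_pos hx, if_pos ((c.color_slide_cap_iff hQ x y z).1 hx), c.color_slide_cap hx]
  · rw [if_neg hx, if_neg (mt (c.color_slide_cap_iff hQ x y z).2 hx)]

theorem colorings_first_cup (c : Crossing) (h : i ≤ s.length) :
    colorings (cup i :: cross c i :: v) s = colorings (cup i :: v) s := by
  obtain ⟨a, -, t, rfl, rfl, -⟩ := exists_eq_append_append (n := 0) h
  simp only [colorings_cup, colorings_cross, Crossing.color_self]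

theorem colorings_first_cap (c : Crossing) (h : i + 2 ≤ s.length) :
    colorings (cross c i :: cap i :: v) s = colorings (cap i :: v) s := by
  obtain ⟨a, b, t, rfl, rfl, hb⟩ := exists_eq_append_append h
  obtain ⟨x, y, rfl⟩ := List.length_eq_two.1 hb
  simp only [List.cons_append, List.nil_append, colorings_cap, colorings_cross,
    Crossing.color_fst_eq_snd_iff]

theorem colorings_second (hQ : Rack.IsInvolutory Q) (c : Crossing) (h : i + 2 ≤ s.length) :
    colorings (cross c i :: cross c.switch i :: v) s = colorings v s := by
  obtain ⟨a, b, t, rfl, rfl, hb⟩ := exists_eq_append_append h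
  obtain ⟨x, y, rfl⟩ := List.length_eq_two.1 hb
  simp only [List.cons_append, List.nil_append, colorings_cross, Crossing.color_switch hQ]

theorem colorings_third (hQ : Rack.IsInvolutory Q) {c₁₂ c₁₃ c₂₃ : Crossing}
    (hc : ThirdMoveAllowed c₁₂ c₁₃ c₂₃) (h : i + 3 ≤ s.length) :
    colorings (cross c₁₂ i :: cross c₁₃ (i + 1) :: cross c₂₃ i :: v) s =
      colorings (cross c₂₃ (i + 1) :: cross c₁₃ i :: cross c₁₂ (i + 1) :: v) s := by
  obtain ⟨a, b, t, rfl, rfl, hb⟩ := exists_eq_append_append h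
  obtain ⟨x, y, z, rfl⟩ := List.length_eq_three.1 hb
  obtain ⟨h₁, h₂, h₃⟩ := Crossing.color_third hQ hc x y z
  simp only [List.cons_append, List.nil_append, colorings_cross, colorings_cross_succ, h₁, h₂, h₃]

theorem colorings_localMove (hQ : Rack.IsInvolutory Q) {l r : Word} (h : LocalMove l r) {k k' : ℕ}
    (hl : Word.width (l ++ v) s.length = some k) (hr : Word.width (r ++ v) s.length = some k') :
    colorings (l ++ v) s = colorings (r ++ v) s := by
  cases h with
  | exchange p q i k => exact colorings_exchange p q (Word.width_cons_eq_some.1 hr).1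
  | zigzag_left i =>
    have := (Word.width_cons_eq_some.1 (Word.width_cons_eq_some.1 hl).2).1
    simp only [Piece.inputs, Piece.outputs] at this
    exact colorings_zigzag_left (by omega)
  | zigzag_right i => exact colorings_zigzag_right (Word.width_cons_eq_some.1 hl).1
  | slide_cup c i => exact colorings_slide_cup hQ c (Word.width_cons_eq_some.1 hr).1
  | slide_cap c i => exact colorings_slide_cap hQ c (Word.width_cons_eq_some.1 hl).1
  | first_cup c i => exact colorings_first_cup c (Word.width_cons_eq_some.1 hl).1
  | first_cap c i => exact colorings_first_cap c (Word.width_cons_eq_some.1 hl).1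
  | second c i => exact colorings_second hQ c (Word.width_cons_eq_some.1 hl).1
  | third _ _ _ hc i => exact colorings_third hQ hc (Word.width_cons_eq_some.1 hr).1

theorem colorings_append_left_congr {l r : Word} (u : Word) {m : ℕ}
    (h : ∀ s : List Q, s.length = m → colorings l s = colorings r s)
    (hu : u.width s.length = some m) : colorings (u ++ l) s = colorings (u ++ r) s := by
  induction u generalizing s with
  | nil => exact h s (by simpa [Word.width] using hu)
  | cons x u ih =>
    obtain ⟨p, i⟩ := x
    obtain ⟨hi, hu⟩ := Word.width_cons_eq_some.1 hu
    obtain ⟨a, b, c, rfl, rfl, hb⟩ := exists_eq_append_append hi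
    rw [List.cons_append, List.cons_append, colorings_cons _ _ _ _ _ hb,
      colorings_cons _ _ _ _ _ hb]
    refine congrArg Multiset.sum (Multiset.map_congr rfl fun o ho => ih ?_)
    rw [← hu]
    congr 1
    simp only [List.length_append, length_of_mem_colors ho, hb]
    omega

theorem Step.colorings_eq (hQ : Rack.IsInvolutory Q) {K K' : VirtualKnotDiagram} (h : Step K K') :
    colorings K.word ([] : List Q) = colorings K'.word ([] : List Q) := by
  obtain ⟨u, l, r, v, hm, hK, hK'⟩ := h
  have hl := K.isClosed
  have hr := K'.isClosed
  rw [hK, Word.IsClosed, List.append_assoc, Word.width_append, Option.bind_eq_some_iff] at hl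
  rw [hK', Word.IsClosed, List.append_assoc, Word.width_append, Option.bind_eq_some_iff] at hr
  obtain ⟨n, hn, hl⟩ := hl
  obtain ⟨n', hn', hr⟩ := hr
  obtain rfl : n = n' := by simpa [hn] using hn'
  rw [hK, hK', List.append_assoc, List.append_assoc]
  refine colorings_append_left_congr u (fun s hs => ?_) hn
  subst hs
  exact colorings_localMove hQ hm hl hr

theorem VirtuallyEquivalent.colorings_eq (hQ : Rack.IsInvolutory Q) {K K' : VirtualKnotDiagram}
    (h : VirtuallyEquivalent K K') :
    colorings K.word ([] : List Q) = colorings K'.word ([] : List Q) := by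
  induction h with
  | rel _ _ h => exact h.colorings_eq hQ
  | refl => rfl
  | symm _ _ _ ih => exact ih.symm
  | trans _ _ _ _ _ ih ih' => exact ih.trans ih'

end Colorings

instance : Fintype (Quandle.Dihedral 3) := inferInstanceAs (Fintype (ZMod 3))

instance : DecidableEq (Quandle.Dihedral 3) := inferInstanceAs (DecidableEq (ZMod 3))

theorem colorings_KD : colorings KD.word ([] : List (Quandle.Dihedral 3)) = 9 := by
  decide +kernel

theorem colorings_unknot : colorings unknot.word ([] : List (Quandle.Dihedral 3)) = 3 := by
  decide +kernel

theorem not_virtuallyEquivalent_KD_unknot : ¬ VirtuallyEquivalent KD unknot := fun h => by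
  have hQ : Rack.IsInvolutory (Quandle.Dihedral 3) := Quandle.dihedralAct.inv 3
  have := colorings_KD.symm.trans ((h.colorings_eq hQ).trans colorings_unknot)
  omega

/-! ### Perfect matchings coded by natural numbers -/

/-- The slot matched with the slot `p`.  A perfect matching of some of the slots `0, …, 31` is coded
by the number whose base `32` digit at a slot is the slot matched with it; the digits at the other
slots are zero. -/
def partner (m p : ℕ) : ℕ := (m >>> (5 * p)) % 32

/-- The code of the matching that consists of the single pair of slots `p` and `q`. -/
def arc (p q : ℕ) : ℕ := (q <<< (5 * p)) ^^^ (p <<< (5 * q))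

/-- The code of the matching in which the slots `p` and `q` are removed from the matching `m` and
their partners are matched with each other. -/
def join (m p q : ℕ) : ℕ :=
  m ^^^ arc p (partner m p) ^^^ arc q (partner m q) ^^^ arc (partner m p) (partner m q)

theorem partner_lt (m p : ℕ) : partner m p < 32 := Nat.mod_lt _ (by norm_num)

theorem testBit_partner (m p i : ℕ) :
    (partner m p).testBit i = (decide (i < 5) && m.testBit (5 * p + i)) := by
  rw [partner, show 32 = 2 ^ 5 by norm_num, Nat.testBit_mod_two_pow, Nat.testBit_shiftRight]

theorem partner_zero (p : ℕ) : partner 0 p = 0 := by simp [partner]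

theorem partner_xor (m n p : ℕ) : partner (m ^^^ n) p = partner m p ^^^ partner n p := by
  refine Nat.eq_of_testBit_eq fun i => ?_
  simp only [testBit_partner, Nat.testBit_xor]
  cases decide (i < 5) <;> simp

theorem partner_shiftLeft {x : ℕ} (hx : x < 32) (p z : ℕ) :
    partner (x <<< (5 * p)) z = if z = p then x else 0 := by
  have testBit_eq_false (j : ℕ) (hj : 5 ≤ j) : x.testBit j = false :=
    Nat.testBit_lt_two_pow (hx.trans_le (Nat.pow_le_pow_right (n := 2) (by norm_num) hj))
  refine Nat.eq_of_testBit_eq fun i => ?_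
  rw [testBit_partner, Nat.testBit_shiftLeft]
  by_cases hi : i < 5
  · rcases lt_trichotomy z p with hz | rfl | hz
    · simp [show ¬ 5 * z + i ≥ 5 * p by omega, hz.ne]
    · simp [hi]
    · simp [hz.ne', testBit_eq_false (5 * z + i - 5 * p) (by omega)]
  · split
    · simp [hi, testBit_eq_false i (by omega)]
    · simp [hi]

theorem partner_arc {p q : ℕ} (hp : p < 32) (hq : q < 32) (hpq : p ≠ q) (z : ℕ) :
    partner (arc p q) z = if z = p then q else if z = q then p else 0 := by
  rw [arc, partner_xor, partner_shiftLeft hq, partner_shiftLeft hp]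
  split_ifs <;> simp_all

theorem join_xor {m p q : ℕ} (hp : partner m p = 0) (hq : partner m q = 0) (n : ℕ) :
    join (m ^^^ n) p q = m ^^^ join n p q := by
  simp only [join, partner_xor, hp, hq, Nat.zero_xor, Nat.xor_assoc]

theorem append_cons_cons_perm {α : Type*} (A t : List α) (p q : α) :
    (A ++ p :: q :: t).Perm (p :: q :: (A ++ t)) :=
  List.perm_middle.trans (List.perm_middle.cons p)

/-- The number `m` codes a perfect matching of the slots in `σ`, and the other slots in `f` are
free. -/
structure IsMatching (m : ℕ) (σ f : List ℕ) : Prop where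
  nodup : (σ ++ f).Nodup
  lt : ∀ p ∈ σ ++ f, p < 32
  partner_eq_zero : ∀ p ∈ f, partner m p = 0
  partner_mem : ∀ p ∈ σ, partner m p ∈ σ
  partner_ne : ∀ p ∈ σ, partner m p ≠ p
  partner_partner : ∀ p ∈ σ, partner m (partner m p) = p

namespace IsMatching

variable {m p q : ℕ} {σ σ' f f' : List ℕ}

theorem nil {n : ℕ} (hn : n ≤ 32) : IsMatching 0 [] (List.range n) where
  nodup := List.nodup_range
  lt p hp := (List.mem_range.1 hp).trans_le hn
  partner_eq_zero p _ := partner_zero p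
  partner_mem := by simp
  partner_ne := by simp
  partner_partner := by simp

theorem perm (h : IsMatching m σ f) (hσ : σ.Perm σ') : IsMatching m σ' f where
  nodup := (hσ.append_right f).nodup_iff.1 h.nodup
  lt p hp := h.lt p ((hσ.append_right f).mem_iff.2 hp)
  partner_eq_zero := h.partner_eq_zero
  partner_mem p hp := hσ.mem_iff.1 (h.partner_mem p (hσ.mem_iff.2 hp))
  partner_ne p hp := h.partner_ne p (hσ.mem_iff.2 hp)
  partner_partner p hp := h.partner_partner p (hσ.mem_iff.2 hp)

theorem notMem_of_cons_cons (h : IsMatching m (p :: q :: σ) f) : p ≠ q ∧ p ∉ σ ∧ q ∉ σ := by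
  have := h.nodup
  simp only [List.cons_append, List.nodup_cons, List.mem_cons, List.mem_append] at this
  tauto

theorem partner_pair (h : IsMatching m σ (p :: q :: f)) (z : ℕ) :
    partner (m ^^^ arc p q) z = if z = p then q else if z = q then p else partner m z := by
  have hpq : p ≠ q := by
    have := h.nodup
    simp only [List.nodup_append, List.nodup_cons, List.mem_cons] at this
    tauto
  rw [partner_xor, partner_arc (h.lt p (by simp)) (h.lt q (by simp)) hpq]
  have := h.partner_eq_zero p (by simp)
  have := h.partner_eq_zero q (by simp)
  split_ifs <;> simp_all

theorem pair (h : IsMatching m σ (p :: q :: f)) : IsMatching (m ^^^ arc p q) (p :: q :: σ) f := by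
  have hperm := append_cons_cons_perm σ f p q
  have nodup := hperm.nodup_iff.1 h.nodup
  have hn := nodup
  simp only [List.nodup_cons, List.mem_cons, List.mem_append] at hn
  refine ⟨nodup, fun x hx => h.lt x (hperm.mem_iff.2 hx), fun x hx => ?_, ?_, ?_, ?_⟩
  · rw [h.partner_pair, if_neg (by grind), if_neg (by grind)]
    exact h.partner_eq_zero x (by simp [hx])
  all_goals
    intro x hx
    simp only [h.partner_pair]
    have := h.partner_mem x
    have := h.partner_ne x
    have := h.partner_partner x
    grind

theorem partner_join (h : IsMatching m (p :: q :: σ) f) (z : ℕ) :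
    partner (join m p q) z = if z = p ∨ z = q then 0 else
      if z = partner m p then partner m q else if z = partner m q then partner m p
      else partner m z := by
  have hpq := h.notMem_of_cons_cons.1
  have hp := h.partner_partner p (by simp)
  have hq := h.partner_partner q (by simp)
  have hp' := (h.partner_ne p (by simp)).symm
  have hq' := (h.partner_ne q (by simp)).symm
  have hne : partner m p ≠ partner m q := fun e => hpq (by rw [← hp, e, hq])
  rw [join, partner_xor, partner_xor, partner_xor,
    partner_arc (h.lt p (by simp)) (partner_lt m p) hp',
    partner_arc (h.lt q (by simp)) (partner_lt m q) hq',
    partner_arc (partner_lt m p) (partner_lt m q) hne]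
  by_cases h₁ : z = p
  · subst h₁
    by_cases h₂ : z = partner m q <;> simp_all
  by_cases h₂ : z = q
  · subst h₂
    by_cases h₂ : z = partner m p <;> simp_all
  split_ifs <;> simp_all

theorem join (h : IsMatching m (p :: q :: σ) f) :
    IsMatching (join m p q) σ (p :: q :: f) := by
  have hperm := append_cons_cons_perm σ f p q
  obtain ⟨hpq, hp, hq⟩ := h.notMem_of_cons_cons
  obtain ⟨partpp, partqq, part⟩ := by simpa using h.partner_partner
  obtain ⟨nep, neq, ne⟩ := by simpa using h.partner_ne
  obtain ⟨memp, memq, mem⟩ := by simpa using h.partner_mem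
  refine ⟨hperm.nodup_iff.2 h.nodup, fun x hx => h.lt x (hperm.mem_iff.1 hx), fun x hx => ?_,
    ?_, ?_, ?_⟩
  · have := h.partner_eq_zero x
    have := h.nodup
    rw [h.partner_join]
    grind
  all_goals
    intro x hx
    simp only [h.partner_join]
    specialize part x hx
    specialize ne x hx
    specialize mem x hx
    clear h hperm
    grind

end IsMatching

/-! ### Labelings of matchings -/

/-- The labels `ℓ` of the strands in the slots `σ`, as in `curvesFrom`, describe the same arcs as
the matching `m`, and labels from `k` on are not in use. -/
structure IsLabeling (ℓ : ℕ → ℕ) (m : ℕ) (σ f : List ℕ) (k : ℕ) : Prop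
    extends IsMatching m σ f where
  label_lt : ∀ p ∈ σ, ℓ p < k
  label_eq_iff : ∀ p ∈ σ, ∀ q ∈ σ, (ℓ p = ℓ q ↔ q = p ∨ q = partner m p)

/-- The labels after a minimum whose ends are in the slots `p` and `q`. -/
def cupLabels (ℓ : ℕ → ℕ) (p q k c : ℕ) : ℕ := if c = p ∨ c = q then k else ℓ c

/-- The labels after a maximum that joins the strands in the slots `p` and `q`. -/
def capLabels (ℓ : ℕ → ℕ) (p q c : ℕ) : ℕ := if ℓ c = ℓ q then ℓ p else ℓ c

namespace IsLabeling

variable {ℓ : ℕ → ℕ} {m k p q : ℕ} {A t σ σ' f : List ℕ}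

theorem nil (ℓ : ℕ → ℕ) (k : ℕ) {n : ℕ} (hn : n ≤ 32) : IsLabeling ℓ 0 [] (List.range n) k where
  __ := IsMatching.nil hn
  label_lt := by simp
  label_eq_iff := by simp

theorem perm (h : IsLabeling ℓ m σ f k) (hσ : σ.Perm σ') : IsLabeling ℓ m σ' f k where
  __ := h.toIsMatching.perm hσ
  label_lt p hp := h.label_lt p (hσ.mem_iff.2 hp)
  label_eq_iff p hp q hq := h.label_eq_iff p (hσ.mem_iff.2 hp) q (hσ.mem_iff.2 hq)

theorem swap (h : IsLabeling ℓ m (A ++ p :: q :: t) f k) :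
    IsLabeling ℓ m (A ++ q :: p :: t) f k :=
  h.perm ((List.Perm.swap q p t).append_left A)

theorem pair (h : IsLabeling ℓ m (A ++ t) (p :: q :: f) k) :
    IsLabeling (cupLabels ℓ p q k) (m ^^^ arc p q) (A ++ p :: q :: t) f (k + 1) := by
  have hm := h.toIsMatching.pair
  obtain ⟨-, hp, hq⟩ := hm.notMem_of_cons_cons
  refine perm ⟨hm, fun x hx => ?_, fun x hx y hy => ?_⟩ (append_cons_cons_perm A t p q).symm
  · have := h.label_lt x
    grind [cupLabels]
  · have hx' := h.label_lt x
    have hy' := h.label_lt y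
    have := h.label_eq_iff x
    have := h.partner_mem x
    rw [h.partner_pair]
    generalize A ++ t = σ at *
    clear h hm
    grind [cupLabels]

theorem map_pair (h : IsLabeling ℓ m (A ++ t) (p :: q :: f) k) :
    (A ++ p :: q :: t).map (cupLabels ℓ p q k) =
      A.map ℓ ++ k :: k :: t.map ℓ := by
  obtain ⟨-, hp, hq⟩ := h.toIsMatching.pair.notMem_of_cons_cons
  have map_eq (B : List ℕ) (hB : B ⊆ A ++ t) :
      B.map (cupLabels ℓ p q k) = B.map ℓ :=
    List.map_congr_left fun c hc => if_neg (by rintro (rfl | rfl) <;> exact absurd (hB hc) ‹_›)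
  simp [map_eq A (by simp), map_eq t (by simp), cupLabels]

theorem label_eq_iff_partner_eq (h : IsLabeling ℓ m (A ++ p :: q :: t) f k) :
    ℓ p = ℓ q ↔ partner m p = q := by
  have hpq := (h.toIsMatching.perm (append_cons_cons_perm A t p q)).notMem_of_cons_cons.1
  rw [h.label_eq_iff p (by simp) q (by simp), eq_comm (b := q)]
  simp [hpq.symm]

theorem append_ne_nil (h : IsLabeling ℓ m (A ++ p :: q :: t) f k) (hpq : ℓ p ≠ ℓ q) :
    A ++ t ≠ [] := fun hAt => by
  have hm := h.toIsMatching.perm (append_cons_cons_perm A t p q)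
  have hmem := hm.partner_mem p (by simp)
  rw [hAt, List.mem_pair] at hmem
  exact hmem.elim (hm.partner_ne p (by simp)) (mt h.label_eq_iff_partner_eq.2 hpq)

theorem join (h : IsLabeling ℓ m (A ++ p :: q :: t) f k) :
    IsLabeling (capLabels ℓ p q) (join m p q) (A ++ t) (p :: q :: f) k := by
  replace h := h.perm (append_cons_cons_perm A t p q)
  generalize A ++ t = σ at h
  obtain ⟨hpq, hp, hq⟩ := h.notMem_of_cons_cons
  obtain ⟨partpp, partqq, part⟩ := by simpa using h.partner_partner
  refine ⟨h.toIsMatching.join, fun x hx => ?_, fun x hx y hy => ?_⟩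
  · have := h.label_lt p (by simp)
    have := h.label_lt x (by simp [hx])
    grind [capLabels]
  · have := h.label_eq_iff p (by simp) x (by simp [hx])
    have := h.label_eq_iff p (by simp) y (by simp [hy])
    have := h.label_eq_iff q (by simp) x (by simp [hx])
    have := h.label_eq_iff q (by simp) y (by simp [hy])
    have := h.label_eq_iff x (by simp [hx]) y (by simp [hy])
    rw [h.partner_join]
    specialize part x hx
    clear h
    grind [capLabels]

end IsLabeling

/-! ### State sums as programs -/

/-- The instructions for the evaluation of a state sum on linear combinations of matchings: a
minimum with the ends `p`, `q`, a maximum that joins `p` and `q`, and a classical crossing of the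
strands `p` and `q`, where `r ^ e` is the weight of the state without a maximum. -/
inductive Instr
  | cup (p q : ℕ)
  | cap (p q : ℕ)
  | cross (e p q : ℕ)

/-- The instructions for a word, where `s` lists the slots of the strands at the bottom from left to
right and `f` the free slots.  Virtual crossings only permute `s`. -/
def compile : Word → List ℕ → List ℕ → Option (List Instr)
  | [], s, _ => if s.isEmpty then some [] else none
  | (.cup, i) :: w, s, f =>
    match f with
    | p :: q :: f =>
      if i ≤ s.length then
        (compile w (s.take i ++ p :: q :: s.drop i) f).map (Instr.cup p q :: ·)
      else none
    | _ => none
  | (.cap, i) :: w, s, f =>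
    match s.drop i with
    | p :: q :: t => (compile w (s.take i ++ t) (p :: q :: f)).map (Instr.cap p q :: ·)
    | _ => none
  | (.cross c, i) :: w, s, f =>
    match s.drop i with
    | p :: q :: t =>
      match c with
      | .virt => compile w (s.take i ++ q :: p :: t) f
      | .over => (compile w s f).map (Instr.cross 0 p q :: ·)
      | .under => (compile w s f).map (Instr.cross 2 p q :: ·)
    | _ => none

/-- The graph of `compile`. -/
inductive Compiles : Word → List ℕ → List ℕ → List Instr → Prop
  | nil (f) : Compiles [] [] f []
  | cup {w A t p q f l} : Compiles w (A ++ p :: q :: t) f l →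
      Compiles (cup A.length :: w) (A ++ t) (p :: q :: f) (.cup p q :: l)
  | cap {w A t p q f l} : Compiles w (A ++ t) (p :: q :: f) l →
      Compiles (cap A.length :: w) (A ++ p :: q :: t) f (.cap p q :: l)
  | cross_virt {w A t p q f l} : Compiles w (A ++ q :: p :: t) f l →
      Compiles (cross .virt A.length :: w) (A ++ p :: q :: t) f l
  | cross_over {w A t p q f l} : Compiles w (A ++ p :: q :: t) f l →
      Compiles (cross .over A.length :: w) (A ++ p :: q :: t) f (.cross 0 p q :: l)
  | cross_under {w A t p q f l} : Compiles w (A ++ p :: q :: t) f l →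
      Compiles (cross .under A.length :: w) (A ++ p :: q :: t) f (.cross 2 p q :: l)

theorem exists_eq_append_of_drop_eq_cons {α : Type*} {s t : List α} {i : ℕ} {p : α}
    (h : s.drop i = p :: t) : ∃ A, s = A ++ p :: t ∧ A.length = i ∧ s.take i = A := by
  refine ⟨s.take i, by rw [← h, List.take_append_drop], ?_, rfl⟩
  have : i < s.length := by
    by_contra hi
    simp [List.drop_eq_nil_of_le (not_lt.1 hi)] at h
  simp [this.le]

theorem compiles_of_compile_eq_some {w : Word} {s f : List ℕ} {l : List Instr}
    (h : compile w s f = some l) : Compiles w s f l := by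
  fun_induction compile w s f generalizing l
  all_goals try simp only [reduceCtorEq, Option.map_eq_some_iff] at h
  case case1 s f hs =>
    obtain rfl := List.isEmpty_iff.1 hs
    obtain rfl : [] = l := by simpa using h
    exact .nil f
  case case3 hi ih =>
    obtain ⟨l, hl, rfl⟩ := h
    simpa [hi] using (ih hl).cup
  all_goals obtain ⟨A, rfl, rfl, hA⟩ := exists_eq_append_of_drop_eq_cons ‹_›
  case case6 _ ih =>
    obtain ⟨l, hl, rfl⟩ := h
    exact (hA ▸ ih hl).cap
  case case8 _ ih => exact (hA ▸ ih h).cross_virt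
  case case9 ih _ =>
    obtain ⟨l, hl, rfl⟩ := h
    exact (ih hl).cross_over
  case case10 ih _ =>
    obtain ⟨l, hl, rfl⟩ := h
    exact (ih hl).cross_under

section evalProgram

variable {R : Type*} [CommRing R]

/-- The weight of a maximum that joins two slots one of which is matched with `x`, where `q` is the
other one: a closed curve if `x = q`. With `r = A⁻²` it is `A⁻² d` or `A⁻²`; the factor `A⁻²` avoids
negative powers of `r`. -/
def capWeight (r : R) (x q : ℕ) : R := if x = q then -(1 + r ^ 2) else r

/-- The state sum of a program that starts with the matching `m`, where a matching at the end has
the weight `F`. -/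
def evalProgram (r : R) (F : ℕ → R) : List Instr → ℕ → R
  | [], m => F m
  | .cup p q :: l, m => evalProgram r F l (m ^^^ arc p q)
  | .cap p q :: l, m => capWeight r (partner m p) q * evalProgram r F l (join m p q)
  | .cross e p q :: l, m => r ^ e * evalProgram r F l m +
      capWeight r (partner m p) q * evalProgram r F l (join m p q ^^^ arc p q)

theorem evalProgram_append (r : R) (F : ℕ → R) (l l' : List Instr) (m : ℕ) :
    evalProgram r F (l ++ l') m = evalProgram r (evalProgram r F l') l m := by
  induction l generalizing m with
  | nil => rfl
  | cons o l ih => cases o <;> simp [evalProgram, ih]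

theorem map_capWeight {S : Type*} [CommRing S] (φ : R →+* S) (r : R) (x q : ℕ) :
    φ (capWeight r x q) = capWeight (φ r) x q := by
  unfold capWeight
  split <;> simp

theorem map_evalProgram {S : Type*} [CommRing S] (φ : R →+* S) (r : R) (F : ℕ → R)
    (l : List Instr) (m : ℕ) :
    φ (evalProgram r F l m) = evalProgram (φ r) (φ ∘ F) l m := by
  induction l generalizing m with
  | nil => rfl
  | cons o l ih => cases o <;> simp [evalProgram, ih, map_capWeight]

/-- The slots of which the instruction depends on the partners are free in the matching `m`. -/
def Instr.avoids (m : ℕ) : Instr → Bool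
  | .cup _ _ => true
  | .cap p q => partner m p == 0 && partner m q == 0
  | .cross _ p q => partner m p == 0 && partner m q == 0

theorem evalProgram_xor {l : List Instr} {m : ℕ} (h : ∀ o ∈ l, o.avoids m) (r : R) (F : ℕ → R)
    (n : ℕ) : evalProgram r F l (m ^^^ n) = evalProgram r (fun n => F (m ^^^ n)) l n := by
  induction l generalizing n with
  | nil => rfl
  | cons o l ih =>
    obtain ⟨ho, hl⟩ := List.forall_mem_cons.1 h
    cases o with
    | cup p q => rw [evalProgram, evalProgram, Nat.xor_assoc, ih hl]
    | cap p q | cross e p q =>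
      obtain ⟨hp, hq⟩ : partner m p = 0 ∧ partner m q = 0 := by simpa [Instr.avoids] using ho
      simp only [evalProgram, partner_xor, hp, Nat.zero_xor, join_xor hp hq, Nat.xor_assoc, ih hl]

end evalProgram

/-! ### Evaluation by the kernel -/

/-- The number that is substituted for the variable `r` of a program. The coefficients of the state
sums are the digits in this base. -/
def base : ℕ := 3 ^ 100

/-- The value of `capWeight` at `r = base`. -/
def baseCapWeight (x q : ℕ) : ℤ :=
  bif x.beq q then Int.negSucc (base * base) else Int.ofNat base

theorem baseCapWeight_eq (x q : ℕ) : baseCapWeight x q = capWeight (base : ℤ) x q := by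
  rw [baseCapWeight, capWeight, Bool.cond_eq_ite]
  simp only [Nat.beq_eq, Int.negSucc_eq, Int.ofNat_eq_natCast]
  push_cast
  ring_nf

/-- A linear combination of matchings, stored as a search tree. A node holds a hash `h` of the
matching `k`, by which the tree is ordered, and the coefficient `x` of `k`. -/
inductive MatchTree
  | leaf
  | node (h k : ℕ) (x : ℤ) (l r : MatchTree)

-- The functions on trees are recursors since the kernel reduces these fastest. It evaluates lazily;
-- a recursion on a number, of which only the constructor matters, makes it compute the number
-- first.
namespace MatchTree

/-- The value of `F` on a linear combination, extended linearly. -/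
def sum (F : ℕ → ℤ) : MatchTree → ℤ
  | leaf => 0
  | node _ k x l r => sum F l + x * F k + sum F r

/-- `f n`, where `n` is evaluated before `f` is applied. -/
noncomputable def forceNat {α : Type} (n : ℕ) (f : ℕ → α) : α :=
  Nat.rec (f 0) (fun n _ => f (Nat.succ n)) n

/-- `f x`, where `x` is evaluated before `f` is applied. -/
noncomputable def forceInt {α : Type} (x : ℤ) (f : ℤ → α) : α :=
  Int.rec (fun n => forceNat n fun n => f (Int.ofNat n))
    (fun n => forceNat n fun n => f (Int.negSucc n)) x

/-- `f t`, where `t` and all its entries are evaluated before `f` is applied. -/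
noncomputable def force {α : Type} (t : MatchTree) : (MatchTree → α) → α :=
  MatchTree.rec (fun f => f leaf)
    (fun h k x _ _ forcel forcer f => forcel fun l => forcer fun r =>
      forceNat h fun h => forceNat k fun k => forceInt x fun x => f (node h k x l r)) t

/-- Add the multiple `x` of the matching `k` with the hash `h`. -/
noncomputable def insertAt (h k : ℕ) (x : ℤ) (t : MatchTree) : MatchTree :=
  MatchTree.rec (node h k x leaf leaf)
    (fun h' k' x' l r insertl insertr =>
      bif k.beq k' then node h' k' (x + x') l r
      else bif h.ble h' then node h' k' x' insertl r
      else node h' k' x' l insertr) t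

/-- Add the multiple `x` of the matching `k`. The hash spreads the codes, so that the tree is
balanced without rotations. -/
noncomputable def insert (k : ℕ) (x : ℤ) (t : MatchTree) : MatchTree :=
  insertAt (k * 982451653 % 1073741789) k x t

/-- Apply `f k x` for every term `x • k` of `t` successively to a tree. -/
noncomputable def fold (f : ℕ → ℤ → MatchTree → MatchTree) (t : MatchTree) :
    MatchTree → MatchTree :=
  MatchTree.rec id (fun _ k x _ _ foldl foldr a => foldr (f k x (foldl a))) t

/-- Multiply all coefficients by `c`. -/
noncomputable def scale (c : ℤ) (t : MatchTree) : MatchTree :=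
  MatchTree.rec leaf (fun h k x _ _ scalel scaler => node h k (c * x) scalel scaler) t

/-- Apply an instruction to a linear combination of matchings. -/
noncomputable def act (t : MatchTree) : Instr → MatchTree
  | .cup p q => t.fold (fun k x => insert (k ^^^ arc p q) x) leaf
  | .cap p q => t.fold (fun k x => insert (join k p q) (baseCapWeight (partner k p) q * x)) leaf
  | .cross e p q =>
    t.fold (fun k x => insert (join k p q ^^^ arc p q) (baseCapWeight (partner k p) q * x))
      (t.scale (Int.ofNat (base ^ e)))

/-- Apply a program and then `f`. -/
noncomputable def run {α : Type} : List Instr → MatchTree → (MatchTree → α) → α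
  | [], t, f => f t
  | o :: l, t, f => force (t.act o) fun t => run l t f

/-- The bilinear extension of the disjoint union of matchings. -/
noncomputable def prod (t t' : MatchTree) : MatchTree :=
  t.fold (fun k x => t'.fold fun k' x' => insert (k ^^^ k') (x * x')) leaf

/-- The program does not change the arcs of any matching in `t`. -/
noncomputable def avoids (l : List Instr) (t : MatchTree) : Bool :=
  MatchTree.rec true (fun _ k _ _ _ avoidsl avoidsr =>
    l.all (Instr.avoids k) && avoidsl && avoidsr) t

/-- The empty matching. -/
def empty : MatchTree := node 0 0 1 leaf leaf

/-- The state sum of `w` at `r = base` is `v`. The program of `w` is split into `a` instructions,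
`b` instructions and the rest; the first two parts are evaluated separately and multiplied. -/
noncomputable def check (w : Word) (n a b : ℕ) (v : ℤ) : Bool :=
  match compile w [] (List.range n) with
  | none => false
  | some l =>
    run (l.take a) empty fun t =>
      avoids ((l.drop a).take b) t &&
        run ((l.drop a).take b) empty fun t' =>
          force (t.prod t') fun t =>
            run ((l.drop a).drop b) t fun t => decide (t.sum (fun _ => 1) = v)

theorem forceNat_eq {α : Type} (n : ℕ) (f : ℕ → α) : forceNat n f = f n := by cases n <;> rfl

theorem forceInt_eq {α : Type} (x : ℤ) (f : ℤ → α) : forceInt x f = f x := by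
  cases x with
  | ofNat n => exact forceNat_eq n fun n => f (Int.ofNat n)
  | negSucc n => exact forceNat_eq n fun n => f (Int.negSucc n)

theorem force_eq {α : Type} (t : MatchTree) (f : MatchTree → α) : force t f = f t := by
  induction t generalizing f with
  | leaf => rfl
  | node h k x l r ihl ihr =>
    refine (ihl _).trans ((ihr _).trans ?_)
    rw [forceNat_eq, forceNat_eq, forceInt_eq]

variable (F : ℕ → ℤ)

theorem sum_insertAt (h k : ℕ) (x : ℤ) (t : MatchTree) :
    (t.insertAt h k x).sum F = t.sum F + x * F k := by
  induction t with
  | leaf => simp [insertAt, sum]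
  | node h' k' x' l r ihl ihr =>
    change sum F (bif k.beq k' then node h' k' (x + x') l r
      else bif h.ble h' then node h' k' x' (l.insertAt h k x) r
      else node h' k' x' l (r.insertAt h k x)) = _
    cases hk : k.beq k'
    · cases h.ble h' <;> simp only [cond_true, cond_false, sum, ihl, ihr] <;> ring
    · rw [cond_true, sum, sum, Nat.eq_of_beq_eq_true hk]
      ring

theorem sum_insert (k : ℕ) (x : ℤ) (t : MatchTree) :
    (t.insert k x).sum F = t.sum F + x * F k :=
  sum_insertAt F _ k x t

theorem sum_fold {f : ℕ → ℤ → MatchTree → MatchTree} {G : ℕ → ℤ}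
    (hf : ∀ k x a, (f k x a).sum F = a.sum F + x * G k) (t a : MatchTree) :
    (t.fold f a).sum F = a.sum F + t.sum G := by
  induction t generalizing a with
  | leaf => simp [fold, sum]
  | node h k x l r ihl ihr =>
    change (r.fold f (f k x (l.fold f a))).sum F = _
    rw [ihr, hf, ihl, sum]
    ring

theorem sum_scale (c : ℤ) (t : MatchTree) : (t.scale c).sum F = c * t.sum F := by
  induction t with
  | leaf => simp [scale, sum]
  | node h k x l r ihl ihr =>
    change (l.scale c).sum F + c * x * F k + (r.scale c).sum F = _
    rw [ihl, ihr, sum]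
    ring

theorem sum_add (G : ℕ → ℤ) (t : MatchTree) :
    t.sum (fun k => F k + G k) = t.sum F + t.sum G := by
  induction t with
  | leaf => rfl
  | node h k x l r ihl ihr => simp only [sum, ihl, ihr]; ring

theorem sum_mul_left (c : ℤ) (t : MatchTree) : t.sum (fun k => c * F k) = c * t.sum F := by
  induction t with
  | leaf => simp [sum]
  | node h k x l r ihl ihr => simp only [sum, ihl, ihr]; ring

theorem sum_empty : empty.sum F = F 0 := by simp [empty, sum]

theorem sum_act (t : MatchTree) (o : Instr) :
    (t.act o).sum F = t.sum (evalProgram (base : ℤ) F [o]) := by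
  cases o with
  | cup p q =>
    rw [act, sum_fold F (G := evalProgram (base : ℤ) F [.cup p q]) fun k x a => sum_insert F _ x a]
    exact zero_add _
  | cap p q =>
    rw [act, sum_fold F (G := evalProgram (base : ℤ) F [.cap p q]) fun k x a => ?_]
    · exact zero_add _
    · rw [sum_insert, baseCapWeight_eq, evalProgram, evalProgram]
      ring
  | cross e p q =>
    rw [act, sum_fold F fun k x a => (sum_insert F _ _ a).trans
        (congrArg _ (by rw [mul_comm _ x, mul_assoc])), sum_scale, ← sum_mul_left, ← sum_add]
    simp only [baseCapWeight_eq, evalProgram, Int.ofNat_eq_natCast, Nat.cast_pow]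

theorem run_eq {α : Type} (l : List Instr) (t : MatchTree) (f : MatchTree → α) :
    run l t f = f (l.foldl act t) := by
  induction l generalizing t with
  | nil => rfl
  | cons o l ih => rw [run, force_eq, ih, List.foldl_cons]

theorem sum_foldl_act (l : List Instr) (t : MatchTree) :
    (l.foldl act t).sum F = t.sum (evalProgram (base : ℤ) F l) := by
  induction l generalizing t with
  | nil => rfl
  | cons o l ih =>
    rw [List.foldl_cons, ih, sum_act]
    exact congrArg t.sum (funext fun m => (evalProgram_append _ F [o] l m).symm)

theorem sum_prod (t t' : MatchTree) :
    (t.prod t').sum F = t.sum fun k => t'.sum fun k' => F (k ^^^ k') := by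
  rw [prod, sum_fold F fun k x a => ?_]
  · exact zero_add _
  · rw [sum_fold F fun k' x' a => (sum_insert F _ _ a).trans
      (congrArg _ (by rw [mul_comm x, mul_assoc])), sum_mul_left]

theorem sum_evalProgram_of_avoids {l : List Instr} {t : MatchTree} (h : t.avoids l) :
    t.sum (evalProgram (base : ℤ) F l) =
      t.sum fun k => evalProgram (base : ℤ) (fun n => F (k ^^^ n)) l 0 := by
  induction t with
  | leaf => rfl
  | node _ k x tl tr ihl ihr =>
    change (l.all (Instr.avoids k) && tl.avoids l && tr.avoids l) = true at h
    simp only [Bool.and_eq_true, List.all_eq_true] at h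
    rw [sum, sum, ihl h.1.2, ihr h.2, ← evalProgram_xor h.1.1, Nat.xor_zero]

theorem evalProgram_of_check {w : Word} {n a b : ℕ} {v : ℤ} (h : check w n a b v) :
    ∃ l, compile w [] (List.range n) = some l ∧
      evalProgram (base : ℤ) (fun _ => 1) l 0 = v := by
  unfold check at h
  split at h
  · simp at h
  next l hl =>
    refine ⟨l, hl, ?_⟩
    simp only [run_eq, force_eq, Bool.and_eq_true, decide_eq_true_eq] at h
    obtain ⟨havoid, hv⟩ := h
    rw [sum_foldl_act, sum_prod] at hv
    simp only [sum_foldl_act _ (l.drop a |>.take b), sum_empty] at hv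
    rw [← sum_evalProgram_of_avoids _ havoid, sum_foldl_act, sum_empty] at hv
    rw [← List.take_append_drop a l, ← List.take_append_drop b (l.drop a), ← List.append_assoc,
      evalProgram_append, evalProgram_append, hv]

end MatchTree

/-! ### State sums -/

open LaurentPolynomial

/-- The state sum of a word whose strands at the bottom carry the labels `s`, as in `curvesFrom`. In
contrast to the bracket polynomial, every closed curve counts. -/
noncomputable def stateSum (w : Word) (s : List ℕ) (k : ℕ) : ℤ[T;T⁻¹] :=
  ((states w).map fun b => T b.2 * d ^ curvesFrom b.1 s k).sum

theorem stateSum_nil (s : List ℕ) (k : ℕ) : stateSum [] s k = 1 := by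
  simp [stateSum, states, curvesFrom]

theorem stateSum_cons (l : Layer) (w : Word) (s : List ℕ) (k : ℕ) :
    stateSum (l :: w) s k = ((smoothings l).map fun a => T a.2 *
      ((states w).map fun b => T b.2 * d ^ curvesFrom (a.1 ++ b.1) s k).sum).sum := by
  simp only [stateSum, states]
  induction smoothings l with
  | nil => rfl
  | cons a as ih =>
    simp only [List.flatMap_cons, List.map_append, List.sum_append, ih, List.map_map,
      List.map_cons, List.sum_cons, ← List.sum_map_mul_left, Function.comp_def, T_add, mul_assoc]

theorem stateSum_over (w : Word) (i : ℕ) (s : List ℕ) (k : ℕ) :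
    stateSum (cross .over i :: w) s k =
      T 1 * stateSum w s k + T (-1) * stateSum (cap i :: cup i :: w) s k := by
  rw [stateSum_cons]
  simp [smoothings, stateSum, states, Function.comp_def]

theorem stateSum_under (w : Word) (i : ℕ) (s : List ℕ) (k : ℕ) :
    stateSum (cross .under i :: w) s k =
      T (-1) * stateSum w s k + T 1 * stateSum (cap i :: cup i :: w) s k := by
  rw [stateSum_cons]
  simp [smoothings, stateSum, states, Function.comp_def, add_comm]

section

variable (w : Word) (ℓ : ℕ → ℕ) (A t : List ℕ) (p q k : ℕ)

theorem curvesFrom_virt :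
    curvesFrom (cross .virt A.length :: w) ((A ++ p :: q :: t).map ℓ) k =
      curvesFrom w ((A ++ q :: p :: t).map ℓ) k := by
  simp [curvesFrom]

theorem stateSum_virt :
    stateSum (cross .virt A.length :: w) ((A ++ p :: q :: t).map ℓ) k =
      stateSum w ((A ++ q :: p :: t).map ℓ) k := by
  rw [stateSum_cons]
  simp only [smoothings, List.cons_append, List.nil_append, curvesFrom_virt, stateSum,
    List.map_cons, List.map_nil, List.sum_cons, List.sum_nil, T_zero, one_mul, add_zero]

theorem curvesFrom_cap :
    curvesFrom (cap A.length :: w) ((A ++ p :: q :: t).map ℓ) k =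
      (if ℓ p = ℓ q then 1 else 0) + curvesFrom w ((A ++ t).map (capLabels ℓ p q)) k := by
  have : capLabels ℓ p q = (fun c => if c = ℓ q then ℓ p else c) ∘ ℓ := rfl
  simp [curvesFrom, this]

theorem stateSum_cap :
    stateSum (cap A.length :: w) ((A ++ p :: q :: t).map ℓ) k =
      (if ℓ p = ℓ q then d else 1) * stateSum w ((A ++ t).map (capLabels ℓ p q)) k := by
  rw [stateSum_cons]
  simp only [smoothings, List.cons_append, List.nil_append, curvesFrom_cap,
    stateSum, List.map_cons, List.map_nil, List.sum_cons, List.sum_nil, ← List.sum_map_mul_left]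
  split <;> simp [pow_add, mul_left_comm]

end

section

variable {w : Word} {ℓ : ℕ → ℕ} {A t σ f : List ℕ} {m p q k : ℕ} {l : List Instr}

theorem IsLabeling.curvesFrom_cup (h : IsLabeling ℓ m (A ++ t) (p :: q :: f) k) (w : Word) :
    curvesFrom (cup A.length :: w) ((A ++ t).map ℓ) k =
      curvesFrom w ((A ++ p :: q :: t).map (cupLabels ℓ p q k)) (k + 1) := by
  rw [h.map_pair]
  simp [curvesFrom]

theorem IsLabeling.stateSum_cup (h : IsLabeling ℓ m (A ++ t) (p :: q :: f) k) (w : Word) :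
    stateSum (cup A.length :: w) ((A ++ t).map ℓ) k =
      stateSum w ((A ++ p :: q :: t).map (cupLabels ℓ p q k)) (k + 1) := by
  rw [stateSum_cons]
  simp only [smoothings, List.cons_append, List.nil_append, h.curvesFrom_cup, stateSum,
    List.map_cons, List.map_nil, List.sum_cons, List.sum_nil, T_zero, one_mul, add_zero]

/-- The exponent of the unit by which the state sum of a word and that of its program differ. -/
def shift : Word → ℤ
  | [] => 0
  | (.cap, _) :: w => 2 + shift w
  | (.cross .over, _) :: w => 1 + shift w
  | (.cross .under, _) :: w => 3 + shift w
  | _ :: w => shift w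

theorem d_eq : d = T 2 * -(1 + T (-2) ^ 2) := by
  have : (T 2 * T (-2) ^ 2 : ℤ[T;T⁻¹]) = T (-2) := by rw [T_pow, ← T_add]; rfl
  rw [d, mul_neg, mul_add, mul_one, this]
  ring

theorem capWeight_T (x q : ℕ) :
    capWeight (T (-2) : ℤ[T;T⁻¹]) x q = T (-2) * if x = q then d else 1 := by
  unfold capWeight
  split
  · have : (T (-2) * T 2 : ℤ[T;T⁻¹]) = 1 := by rw [← T_add]; exact T_zero
    rw [d_eq, ← mul_assoc, this, one_mul]
  · rw [mul_one]

theorem stateSum_eq_T_mul_evalProgram (hl : Compiles w σ f l) (h : IsLabeling ℓ m σ f k) :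
    stateSum w (σ.map ℓ) k = T (shift w) * evalProgram (T (-2)) (fun _ => 1) l m := by
  induction hl generalizing ℓ m k with
  | nil => simp [stateSum_nil, shift, evalProgram]
  | cup _ ih => exact (h.stateSum_cup _).trans (ih h.pair)
  | @cap w _ _ p q _ l _ ih =>
    rw [stateSum_cap, ih h.join, shift, evalProgram, capWeight_T, T_add]
    simp only [h.label_eq_iff_partner_eq]
    have : (T 2 * T (-2) : ℤ[T;T⁻¹]) = 1 := by rw [← T_add]; exact T_zero
    linear_combination -(if partner m p = q then d else 1) * T (shift w) *
      evalProgram (T (-2)) (fun _ => 1) l (join m p q) * this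
  | cross_virt _ ih => exact (stateSum_virt ..).trans (ih h.swap)
  | @cross_over w _ _ p q _ l _ ih =>
    rw [stateSum_over, ih h, stateSum_cap, h.join.stateSum_cup, ih h.join.pair, shift, evalProgram,
      capWeight_T, T_add]
    simp only [h.label_eq_iff_partner_eq]
    have : (T 1 * T (-2) : ℤ[T;T⁻¹]) = T (-1) := by rw [← T_add]; rfl
    linear_combination -(if partner m p = q then d else 1) * T (shift w) *
      evalProgram (T (-2)) (fun _ => 1) l (join m p q ^^^ arc p q) * this
  | @cross_under w _ _ p q _ l _ ih =>
    rw [stateSum_under, ih h, stateSum_cap, h.join.stateSum_cup, ih h.join.pair, shift, evalProgram,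
      capWeight_T, T_add]
    simp only [h.label_eq_iff_partner_eq]
    have h₁ : (T 3 * T (-2) : ℤ[T;T⁻¹]) = T 1 := by rw [← T_add]; rfl
    have h₂ : (T 3 * T (-2) ^ 2 : ℤ[T;T⁻¹]) = T (-1) := by rw [T_pow, ← T_add]; rfl
    linear_combination -(if partner m p = q then d else 1) * T (shift w) *
      evalProgram (T (-2)) (fun _ => 1) l (join m p q ^^^ arc p q) * h₁ -
      T (shift w) * evalProgram (T (-2)) (fun _ => 1) l m * h₂

theorem forall_mem_states_cons_le_curvesFrom {n : ℕ} {x : Layer} {r : List ℕ} :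
    (∀ s ∈ states (x :: w), n ≤ curvesFrom s.1 r k) ↔
      ∀ a ∈ smoothings x, ∀ s ∈ states w, n ≤ curvesFrom (a.1 ++ s.1) r k := by
  simp only [states, List.mem_flatMap, List.mem_map]
  refine ⟨fun h a ha s hs => h _ ⟨a, ha, s, hs, rfl⟩, ?_⟩
  rintro h _ ⟨a, ha, s, hs, rfl⟩
  exact h a ha s hs

theorem Compiles.ne_nil (h : Compiles w σ f l) (hσ : σ ≠ []) : w ≠ [] := by
  rintro rfl
  cases h
  exact hσ rfl

theorem one_le_curvesFrom (hl : Compiles w σ f l) (hw : w ≠ []) (h : IsLabeling ℓ m σ f k) :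
    ∀ s ∈ states w, 1 ≤ curvesFrom s.1 (σ.map ℓ) k := by
  induction hl generalizing ℓ m k with
  | nil => exact absurd rfl hw
  | cup hl ih =>
    simpa only [forall_mem_states_cons_le_curvesFrom, smoothings, List.forall_mem_singleton,
      List.cons_append, List.nil_append, h.curvesFrom_cup] using ih (hl.ne_nil (by simp)) h.pair
  | cap hl ih =>
    simp only [forall_mem_states_cons_le_curvesFrom, smoothings, List.forall_mem_singleton,
      List.cons_append, List.nil_append, curvesFrom_cap]
    intro s hs
    split
    · exact Nat.le_add_right 1 _
    · next hpq => exact le_add_left (ih (hl.ne_nil (h.append_ne_nil hpq)) h.join s hs)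
  | cross_virt hl ih =>
    simpa only [forall_mem_states_cons_le_curvesFrom, smoothings, List.forall_mem_singleton,
      List.cons_append, List.nil_append, curvesFrom_virt] using ih (hl.ne_nil (by simp)) h.swap
  | cross_over hl ih | cross_under hl ih =>
    have hw := hl.ne_nil (by simp)
    simp only [forall_mem_states_cons_le_curvesFrom, smoothings, List.forall_mem_cons,
      List.not_mem_nil, List.cons_append, List.nil_append, curvesFrom_cap, h.join.curvesFrom_cup]
    have horizontal (n : ℕ) := fun s hs => le_add_left (b := n) (ih hw h.join.pair s hs)
    first
    | exact ⟨ih hw h, horizontal _, by simp⟩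
    | exact ⟨horizontal _, ih hw h, by simp⟩

theorem bracket_mul_d {n : ℕ} (hl : Compiles w [] (List.range n) l) (hn : n ≤ 32) (hw : w ≠ []) :
    bracket w * d = T (shift w) * evalProgram (T (-2)) (fun _ => 1) l 0 := by
  have h := IsLabeling.nil id 0 hn
  rw [← stateSum_eq_T_mul_evalProgram hl h, bracket, stateSum, ← List.sum_map_mul_right]
  refine congrArg List.sum (List.map_congr_left fun s hs => ?_)
  rw [Word.curves, mul_assoc, ← pow_succ]
  exact congrArg (_ * d ^ ·) (Nat.sub_add_cancel (one_le_curvesFrom hl hw h s hs))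

end

/-! ### Kronecker substitution -/

section

open Polynomial

/-- All coefficients of `p` have absolute value at most `B`. -/
def Bounded (p : ℤ[X]) (B : ℕ) : Prop := ∀ i, |p.coeff i| ≤ B

namespace Bounded

variable {p q : ℤ[X]} {B B' : ℕ}

theorem one : Bounded 1 1 := fun i => by
  rw [coeff_one]
  split <;> simp

theorem mono (hp : Bounded p B) (h : B ≤ B') : Bounded p B' :=
  fun i => (hp i).trans (by exact_mod_cast h)

theorem neg (hp : Bounded p B) : Bounded (-p) B := fun i => by
  rw [coeff_neg, abs_neg]
  exact hp i

theorem add (hp : Bounded p B) (hq : Bounded q B') : Bounded (p + q) (B + B') := fun i => by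
  rw [coeff_add]
  push_cast
  exact (abs_add_le _ _).trans (add_le_add (hp i) (hq i))

theorem X_pow_mul (hp : Bounded p B) (n : ℕ) : Bounded (X ^ n * p) B := fun i => by
  rw [coeff_X_pow_mul']
  split
  · exact hp _
  · simp

theorem loop_mul (hp : Bounded p B) : Bounded (-(1 + X ^ 2) * p) (2 * B) := by
  rw [show -(1 + X ^ 2) * p = -(p + X ^ 2 * p) by ring, two_mul]
  exact (hp.add (hp.X_pow_mul 2)).neg

theorem capWeight_mul (hp : Bounded p B) (x y : ℕ) : Bounded (capWeight X x y * p) (2 * B) := by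
  unfold capWeight
  split
  · exact hp.loop_mul
  · simpa using (hp.X_pow_mul 1).mono (Nat.le_mul_of_pos_left B two_pos)

/-- A polynomial with small coefficients is determined by its value at one large number: the
coefficients are the digits. -/
theorem eq_zero_of_eval_eq_zero {N : ℕ} (hp : Bounded p B) (hB : B < N)
    (h : p.eval (N : ℤ) = 0) : p = 0 := by
  ext i
  rw [coeff_zero]
  induction i using Nat.strong_induction_on with
  | _ i ih =>
    obtain ⟨g, rfl⟩ : (X ^ i : ℤ[X]) ∣ p := X_pow_dvd_iff.2 ih
    have hcoeff : (X ^ i * g).coeff i = g.coeff 0 := by simp [coeff_X_pow_mul']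
    have hroot : g.eval (N : ℤ) = 0 := by
      rw [eval_mul, eval_pow, eval_X] at h
      exact (mul_eq_zero.1 h).resolve_left (pow_ne_zero _ (by omega))
    have hdvd : (N : ℤ) ∣ g.coeff 0 := by
      simpa [hroot, coeff_zero_eq_eval_zero] using sub_dvd_eval_sub (N : ℤ) 0 g
    have hlt := (hp i).trans_lt (Nat.cast_lt.2 hB)
    rw [hcoeff] at hlt ⊢
    exact Int.eq_zero_of_abs_lt_dvd hdvd hlt

end Bounded

/-- A bound for the coefficients of the state sum of the program of a word. -/
def coeffBound : Word → ℕ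
  | [] => 1
  | (.cup, _) :: w => coeffBound w
  | (.cap, _) :: w => 2 * coeffBound w
  | (.cross .virt, _) :: w => coeffBound w
  | (.cross _, _) :: w => 3 * coeffBound w

theorem Compiles.bounded_evalProgram {w : Word} {σ f : List ℕ} {l : List Instr}
    (h : Compiles w σ f l) (m : ℕ) :
    Bounded (evalProgram X (fun _ => 1) l m) (coeffBound w) := by
  induction h generalizing m with
  | nil => exact .one
  | cup _ ih => exact ih _
  | cap _ ih => exact (ih _).capWeight_mul _ _
  | cross_virt _ ih => exact ih m
  | cross_over _ ih | cross_under _ ih =>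
    exact (((ih m).X_pow_mul _).add ((ih _).capWeight_mul _ _)).mono
      (by simp only [coeffBound]; omega)

/-- The value at `r` of the polynomial with the coefficients `L`, that of lowest degree first. -/
def horner {R : Type*} [CommRing R] (r : R) (L : List ℤ) : R :=
  L.foldr (fun (c : ℤ) x => c + r * x) 0

theorem horner_cons {R : Type*} [CommRing R] (r : R) (c : ℤ) (L : List ℤ) :
    horner r (c :: L) = c + r * horner r L := rfl

theorem map_horner {R S : Type*} [CommRing R] [CommRing S] (φ : R →+* S) (r : R) (L : List ℤ) :
    φ (horner r L) = horner (φ r) L := by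
  induction L with
  | nil => simp [horner]
  | cons c L ih => simpa [horner] using congrArg (c + φ r * ·) ih

theorem bounded_horner {L : List ℤ} {B : ℕ} (h : ∀ c ∈ L, |c| ≤ B) : Bounded (horner X L) B := by
  induction L with
  | nil => exact fun i => by simp [horner]
  | cons c L ih =>
    obtain ⟨hc, hL⟩ := List.forall_mem_cons.1 h
    rintro (_ | i)
    · simpa [horner] using hc
    · have : (c : ℤ[X]).coeff (i + 1) = 0 := coeff_C_succ
      simpa [horner, this] using ih hL i

variable {w : Word} {n a b j : ℕ} {L : List ℤ}

theorem evalProgram_X_eq_of_check (hL : ∀ c ∈ L, |c| ≤ coeffBound w) (hB : 3 * coeffBound w < base)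
    (h : MatchTree.check w n a b (-(1 + base ^ 2) * (base ^ j * horner (base : ℤ) L))) :
    ∃ l, Compiles w [] (List.range n) l ∧
      evalProgram X (fun _ => 1) l 0 = -(1 + X ^ 2) * (X ^ j * horner (X : ℤ[X]) L) := by
  obtain ⟨l, hl, hv⟩ := MatchTree.evalProgram_of_check h
  replace hl := compiles_of_compile_eq_some hl
  have hbounded := (hl.bounded_evalProgram 0).add ((bounded_horner hL).X_pow_mul j).loop_mul.neg
  refine ⟨l, hl, sub_eq_zero.1 ?_⟩
  rw [← sub_eq_add_neg] at hbounded
  refine hbounded.eq_zero_of_eval_eq_zero (N := base) (by omega) ?_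
  have hmap := map_evalProgram (evalRingHom (base : ℤ)) X (fun _ => 1) l 0
  have hhorner := map_horner (evalRingHom (base : ℤ)) X L
  simp only [coe_evalRingHom, eval_X, Function.comp_def, eval_one] at hmap hhorner
  simp [hmap, hhorner, hv]

end

theorem d_ne_zero : d ≠ 0 := fun h => by
  simpa [d] using congrArg (LaurentPolynomial.eval₂ (RingHom.id ℤ) 1) h

theorem bracket_eq_of_check {w : Word} {n a b j : ℕ} {L : List ℤ} {e : ℤ} (hw : w ≠ [])
    (hn : n ≤ 32) (he : shift w - 2 - 2 * j = e)
    (hL : ∀ c ∈ L, |c| ≤ coeffBound w) (hB : 3 * coeffBound w < base)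
    (h : MatchTree.check w n a b (-(1 + base ^ 2) * (base ^ j * horner (base : ℤ) L))) :
    bracket w = T e * horner (T (-2)) L := by
  obtain ⟨l, hl, hX⟩ := evalProgram_X_eq_of_check hL hB h
  let φ := Polynomial.eval₂RingHom (Int.castRingHom ℤ[T;T⁻¹]) (T (-2))
  have hφ : φ .X = T (-2) := Polynomial.eval₂_X ..
  have hT := congrArg φ hX
  rw [map_evalProgram] at hT
  simp only [map_mul, map_neg, map_add, map_one, map_pow, map_horner, hφ, Function.comp_def] at hT
  refine mul_right_cancel₀ d_ne_zero ((bracket_mul_d hl hn hw).trans ?_)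
  have hshift : (T (shift w) * T (-2) ^ j : ℤ[T;T⁻¹]) = T (shift w - 2 - 2 * j) * T 2 := by
    rw [T_pow, ← T_add, ← T_add]
    ring_nf
  rw [hT, d_eq, ← he]
  linear_combination -(1 + T (-2) ^ 2) * horner (T (-2)) L * hshift

/-! ### The brackets of the unknot and of `K_D` -/

theorem one_eq_horner : (1 : ℤ[T;T⁻¹]) = T 0 * horner (T (-2)) [1] := by
  simp [horner]

theorem d_eq_horner : d = T 2 * horner (T (-2)) [-1, 0, -1] := by
  simp only [d_eq, horner, List.foldr_cons, List.foldr_nil]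
  push_cast
  ring

theorem d_sq_eq_horner : d ^ 2 = T 4 * horner (T (-2)) [1, 0, 2, 0, 1] := by
  have hT : (T 2 ^ 2 : ℤ[T;T⁻¹]) = T 4 := T_pow 2 2
  simp only [d_eq, mul_pow, hT, horner, List.foldr_cons, List.foldr_nil]
  push_cast
  ring

theorem bracket_unknot : unknot.bracket = 1 := by
  refine (bracket_eq_of_check (n := 2) (a := 0) (b := 0) (j := 0) (L := [1])
    ?_ ?_ ?_ ?_ ?_ ?_).trans one_eq_horner.symm
  all_goals decide +kernel

theorem strandBracket_two_unknot : unknot.strandBracket 2 = d := by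
  refine (bracket_eq_of_check (n := 4) (a := 0) (b := 0) (j := 0) (L := [-1, 0, -1])
    ?_ ?_ ?_ ?_ ?_ ?_).trans d_eq_horner.symm
  all_goals decide +kernel

theorem strandBracket_three_unknot : unknot.strandBracket 3 = d ^ 2 := by
  refine (bracket_eq_of_check (n := 6) (a := 0) (b := 0) (j := 0) (L := [1, 0, 2, 0, 1])
    ?_ ?_ ?_ ?_ ?_ ?_).trans d_sq_eq_horner.symm
  all_goals decide +kernel

theorem bracket_KD : KD.bracket = 1 := by
  refine (bracket_eq_of_check (n := 6) (a := 0) (b := 0) (j := 12) (L := [1])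
    ?_ ?_ ?_ ?_ ?_ ?_).trans one_eq_horner.symm
  all_goals decide +kernel

theorem strandBracket_two_KD : KD.strandBracket 2 = d := by
  refine (bracket_eq_of_check (n := 12) (a := 0) (b := 0) (j := 40) (L := [-1, 0, -1])
    ?_ ?_ ?_ ?_ ?_ ?_).trans d_eq_horner.symm
  all_goals decide +kernel

/-- The coefficients of `⟨K_D⟩₃` at `A⁷⁸`, `A⁷⁶`, …, `A⁻⁷⁸`. -/
def coeffsKD : List ℤ := [
  -1, 0, 1, 2, 5, 10, 21, 25, 26, 22, 10, -16, -64, -116, -169, -209, -239, -225, -147, -1,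
  198, 436, 700, 927, 1050, 981, 737, 238, -416, -1192, -1923, -2384, -2544, -2148, -1408,
  -241, 1064, 2233, 3099, 3320, 3099, 2233, 1064, -241, -1408, -2148, -2544, -2384, -1923,
  -1192, -416, 238, 737, 981, 1050, 927, 700, 436, 198, -1, -147, -225, -239, -209, -169,
  -116, -64, -16, 10, 22, 26, 25, 21, 10, 5, 2, 1, 0, -1]

-- The first `51` instructions act on the slots of the first tangle, the next `45` on those of the
-- second one.
theorem strandBracket_three_KD : KD.strandBracket 3 = T 78 * horner (T (-2)) coeffsKD := by
  refine bracket_eq_of_check (n := 18) (a := 51) (b := 45) (j := 47) ?_ ?_ ?_ ?_ ?_ ?_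
  all_goals decide +kernel

theorem T_mul_horner_nil (e : ℤ) : (T e * horner (T (-2)) [] : ℤ[T;T⁻¹]) = 0 := mul_zero _

theorem T_mul_horner_cons (e c : ℤ) (L : List ℤ) :
    (T e * horner (T (-2)) (c :: L) : ℤ[T;T⁻¹]) =
      (c : ℤ[T;T⁻¹]) * T e + T (e - 2) * horner (T (-2)) L := by
  rw [horner_cons, sub_eq_add_neg, T_add]
  ring

theorem strandBracket_three_KD_ne : KD.strandBracket 3 ≠ d ^ 2 := fun h => by
  rw [strandBracket_three_KD, d_sq_eq_horner] at h
  have := congrArg (LaurentPolynomial.eval₂ (Int.castRingHom (ZMod 11)) ⟨3, 4, rfl, rfl⟩) h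
  simp only [map_mul, map_horner, eval₂_T] at this
  revert this
  decide +kernel

end VirtualKnot

open VirtualKnot LaurentPolynomial in
theorem mainTheorem5 :
    (unknot.bracket = 1 ∧ unknot.strandBracket 2 = d ∧ unknot.strandBracket 3 = d ^ 2) ∧
    KD.bracket = 1 ∧
    KD.strandBracket 2 = d ∧
    KD.strandBracket 3 = d * (
          -1842 + (T 76 + T (-76)) - 2 * (T 72 + T (-72)) - 2 * (T 70 + T (-70))
          - 3 * (T 68 + T (-68)) - 8 * (T 66 + T (-66)) - 18 * (T 64 + T (-64))
          - 17 * (T 62 + T (-62)) - 8 * (T 60 + T (-60)) - 5 * (T 58 + T (-58))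
          - 2 * (T 56 + T (-56)) + 21 * (T 54 + T (-54)) + 66 * (T 52 + T (-52))
          + 95 * (T 50 + T (-50)) + 103 * (T 48 + T (-48)) + 114 * (T 46 + T (-46))
          + 136 * (T 44 + T (-44)) + 111 * (T 42 + T (-42)) + 11 * (T 40 + T (-40))
          - 110 * (T 38 + T (-38)) - 209 * (T 36 + T (-36)) - 326 * (T 34 + T (-34))
          - 491 * (T 32 + T (-32)) - 601 * (T 30 + T (-30)) - 559 * (T 28 + T (-28))
          - 380 * (T 26 + T (-26)) - 178 * (T 24 + T (-24)) + 142 * (T 22 + T (-22))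
          + 594 * (T 20 + T (-20)) + 1050 * (T 18 + T (-18)) + 1329 * (T 16 + T (-16))
          + 1334 * (T 14 + T (-14)) + 1215 * (T 12 + T (-12)) + 814 * (T 10 + T (-10))
          + 193 * (T 8 + T (-8)) - 573 * (T 6 + T (-6)) - 1257 * (T 4 + T (-4))
          - 1660 * (T 2 + T (-2))) ∧
    KD.strandBracket 3 ≠ d ^ 2 ∧
    ¬ VirtuallyEquivalent KD unknot := by
  refine ⟨⟨bracket_unknot, strandBracket_two_unknot, strandBracket_three_unknot⟩, bracket_KD,
    strandBracket_two_KD, ?_, strandBracket_three_KD_ne, not_virtuallyEquivalent_KD_unknot⟩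
  rw [strandBracket_three_KD]
  simp only [coeffsKD, T_mul_horner_cons, T_mul_horner_nil, d, mul_add, mul_sub, sub_mul, neg_mul,
    ← T_add]
  norm_num
  ring
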